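/- Let $\mathbb{K}$ be a field of characteristic zero, $n\ge 1$, and let $F=(f_1,\dots,f_n)$ with $f_i\in R=\mathbb{K}[x_1,\dots,x_n]$. Let $\hat{x}\in\mathbb{K}^n$ be an isolated root of $F$, i.e. the maximal ideal $m_{\hat x}=(x_1-\hat x_1,\dots,x_n-\hat x_n)$ is a minimal prime over $I=(f_1,\dots,f_n)$; let $Q_{\hat x}$ be the primary component of $I$ belonging to $m_{\hat x}$ and let $\mu=\dim_{\mathbb{K}} R/Q_{\hat x}$ be the multiplicity of $\hat x$. Suppose that the Jacobian matrix $J_F(\hat x)$ has corank exactly one, i.e. rank $n-1$. The deflated system is defined as follows. Let $b=(b_0,\dots,b_{\mu-2})$, $a_2=(1,a_{2,2},\dots,a_{2,n})^T$, $a_k=(0,a_{k,2},\dots,a_{k,n})^T$ for $2<k\le\mu$, and let $a$ denote the collection of all the $a_{k,j}$ with $2\le k\le\mu$, $2\le j\le n$. For a system $H$ of $n$ polynomials let $J_H$ be its Jacobian matrix with respect to $x_1,\dots,x_n$ only, and put $L_1(H)=H$ and, for $2\le k\le\mu$, $$L_k(H)=P_k(H)+J_H\,a_k,\qquad P_k(H)=\sum_{j=1}^{k-2}\frac{j}{k-1}\,J_{L_{k-j}(H)}\,a_{j+1}.$$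 Let $$F_1(x,b)=F(x)-\Big(\sum_{\nu=0}^{\mu-2}\frac{b_\nu x_1^\nu}{\nu!}\Big)e_1,\qquad F_k=L_k(F_1)\ (2\le k\le\mu),\qquad G(x,b,a)=(F_1,F_2,\dots,F_\mu),$$ a system of $\mu n$ polynomials in $\mu n$ unknowns, and let $J_G$ be its Jacobian matrix with respect to all the unknowns $(x,b,a)$. (1) Assume that the first row of $J_F(\hat x)$ is a linear combination of its other rows and the first column of $J_F(\hat x)$ is a linear combination of its other columns. Then the matrix consisting of the last $n-1$ columns of $J_F(\hat x)$ together with $e_1$ has rank $n$. Moreover, there is a parameter value $\hat a$ with $G(\hat x,0,\hat a)=0$, and for every such $\hat a$ the Jacobian matrix $J_G(\hat x,0,\hat a)$ is nonsingular. (2) Consequently, without the assumption in (1), a regular augmented system always exists: after a suitable exchange of variables $x_1\leftrightarrow x_s$ and of equations $f_1\leftrightarrow f_t$ the assumption in (1) holds, and the deflated system $G$ of the exchanged system has, at the correspondingly exchanged root $\hat x$ and $b=0$, a parameter value $\hat a$ with $G(\hat x,0,\hat a)=0$ and $J_G(\hat x,0,\hat a)$ nonsingular. -/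

import Mathlib

open MvPolynomial

noncomputable section

namespace BreadthOne

/- Throughout, a square polynomial system in the `n + 1` variables `x_1, …, x_{n+1}` is a map
`F : Fin (n + 1) → MvPolynomial (Fin (n + 1)) K`; the first variable and the first equation have
index `0`, and the other ones have the indices `j.succ` with `j : Fin n`. -/

section Root

variable {K : Type*} [Field K] {n : ℕ}

/-- The ideal `(f_1, …, f_{n+1})`. -/
def systemIdeal (F : Fin (n + 1) → MvPolynomial (Fin (n + 1)) K) :
    Ideal (MvPolynomial (Fin (n + 1)) K) :=
  Ideal.span (Set.range F)

/-- `x` is an isolated root of `F`: the maximal ideal of the polynomials vanishing at `x` is a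
minimal prime over the ideal generated by `F`. -/
def IsIsolatedRoot (F : Fin (n + 1) → MvPolynomial (Fin (n + 1)) K) (x : Fin (n + 1) → K) : Prop :=
  vanishingIdeal K {x} ∈ (systemIdeal F).minimalPrimes

/-- The primary component of the ideal of `F` at an isolated root `x`: the contraction of the
extension of the ideal to the local ring at `x`. -/
def primaryComponent (F : Fin (n + 1) → MvPolynomial (Fin (n + 1)) K) (x : Fin (n + 1) → K) :
    Ideal (MvPolynomial (Fin (n + 1)) K) :=
  ((systemIdeal F).map (algebraMap (MvPolynomial (Fin (n + 1)) K)
      (Localization.AtPrime (vanishingIdeal K {x})))).comap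
    (algebraMap (MvPolynomial (Fin (n + 1)) K)
      (Localization.AtPrime (vanishingIdeal K {x})))

/-- The multiplicity of an isolated root: the dimension over `K` of the quotient of the polynomial
ring by the primary component. -/
def multiplicity (F : Fin (n + 1) → MvPolynomial (Fin (n + 1)) K) (x : Fin (n + 1) → K) : ℕ :=
  Module.finrank K (MvPolynomial (Fin (n + 1)) K ⧸ primaryComponent F x)

/-- The Jacobian matrix `J_F(x)`. -/
def jacobian (F : Fin (n + 1) → MvPolynomial (Fin (n + 1)) K) (x : Fin (n + 1) → K) :
    Matrix (Fin (n + 1)) (Fin (n + 1)) K :=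
  Matrix.of fun i j => eval x (pderiv j (F i))

/-- The last columns (all but the first one) of `J_F(x)`. -/
def lastColumns (F : Fin (n + 1) → MvPolynomial (Fin (n + 1)) K) (x : Fin (n + 1) → K) :
    Matrix (Fin (n + 1)) (Fin n) K :=
  (jacobian F x).submatrix id Fin.succ

/-- The first column of the matrix is a linear combination of its other columns, and the first row
is a linear combination of its other rows. -/
def FirstRowColDependent (M : Matrix (Fin (n + 1)) (Fin (n + 1)) K) : Prop :=
  (fun i => M i 0) ∈ Submodule.span K (Set.range fun j : Fin n => fun i => M i j.succ) ∧
    (fun j => M 0 j) ∈ Submodule.span K (Set.range fun i : Fin n => fun j => M i.succ j)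

/-- The system obtained from `F` by the exchanges `x_1 ↔ x_s` of variables and `f_1 ↔ f_t` of
equations. -/
def exchange (s t : Fin (n + 1)) (F : Fin (n + 1) → MvPolynomial (Fin (n + 1)) K) :
    Fin (n + 1) → MvPolynomial (Fin (n + 1)) K :=
  fun i => rename (Equiv.swap 0 s) (F (Equiv.swap 0 t i))

/-- The point obtained from `x` by exchanging its first and its `s`-th coordinate. -/
def exchangePoint (s : Fin (n + 1)) (x : Fin (n + 1) → K) : Fin (n + 1) → K :=
  fun i => x (Equiv.swap 0 s i)

end Root

section Deflation

/-- The unknowns of the deflated system: `x_1, …, x_{n+1}`, then `b_0, …, b_{μ-2}`, then the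
parameters `a_{k,j}` with `2 ≤ k ≤ μ` and `2 ≤ j ≤ n + 1`, where `a_{k,j}` has the index
`(k - 2, j - 2)`. -/
abbrev Unknown (n μ : ℕ) : Type :=
  Fin (n + 1) ⊕ Fin (μ - 1) ⊕ (Fin (μ - 1) × Fin n)

variable (K : Type*) [Field K] (n μ : ℕ)

/-- The unknown `x_i`. -/
def xVar (i : Fin (n + 1)) : Unknown n μ := Sum.inl i

/-- The unknown `b_ν`. -/
def bVar (ν : Fin (μ - 1)) : Unknown n μ := Sum.inr (Sum.inl ν)

/-- The unknown with index `(m, j)` among the `a`-parameters. -/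
def aVar (m : Fin (μ - 1)) (j : Fin n) : Unknown n μ := Sum.inr (Sum.inr (m, j))

/-- The vector of unknowns `a_{m+2}`: its first entry is `1` for `m = 0` and `0` for `m > 0`, and its
other entries are unknowns. (Only the indices `m < μ - 1` matter.) -/
def aVec (m : ℕ) : Fin (n + 1) → MvPolynomial (Unknown n μ) K :=
  Fin.cons (if m = 0 then 1 else 0)
    (fun j => if h : m < μ - 1 then X (aVar n μ ⟨m, h⟩ j) else 0)

variable {K n μ}

/-- The Jacobian matrix of `H` with respect to the unknowns `x_1, …, x_{n+1}` only. -/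
def jacobianX (H : Fin (n + 1) → MvPolynomial (Unknown n μ) K) :
    Matrix (Fin (n + 1)) (Fin (n + 1)) (MvPolynomial (Unknown n μ) K) :=
  Matrix.of fun i j => pderiv (xVar n μ j) (H i)

/-- `diffOp H m` is `L_{m+1}(H)`, where `L_1(H) = H` and, for `k = m + 2`,
`L_k(H) = P_k(H) + J_H a_k` with `P_k(H) = ∑_{j=1}^{k-2} j / (k-1) • J_{L_{k-j}(H)} a_{j+1}`;
the summation index here is `i = j - 1`. -/
def diffOp (H : Fin (n + 1) → MvPolynomial (Unknown n μ) K) :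
    ℕ → Fin (n + 1) → MvPolynomial (Unknown n μ) K
  | 0 => H
  | m + 1 =>
    (∑ i : Fin m, (((i : ℕ) + 1 : K) / (m + 1 : K)) •
        (jacobianX (diffOp H (m - i))).mulVec (aVec K n μ i)) +
      (jacobianX H).mulVec (aVec K n μ m)
  termination_by m => m
  decreasing_by omega

/-- `F_1(x, b) = F(x) - (∑_{ν=0}^{μ-2} b_ν x_1^ν / ν!) e_1`. -/
def perturbed (μ : ℕ) (F : Fin (n + 1) → MvPolynomial (Fin (n + 1)) K) :
    Fin (n + 1) → MvPolynomial (Unknown n μ) K :=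
  fun i => rename (xVar n μ) (F i) -
    (∑ ν : Fin (μ - 1), C (((ν : ℕ).factorial : K)⁻¹) * X (bVar n μ ν) *
      X (xVar n μ 0) ^ (ν : ℕ)) * (if i = 0 then 1 else 0)

/-- The deflated system `G(x, b, a) = (F_1, …, F_μ)` with `F_k = L_k(F_1)`; the block of `F_k` has the
index `k - 1`. -/
def deflated (μ : ℕ) (F : Fin (n + 1) → MvPolynomial (Fin (n + 1)) K) :
    Fin μ × Fin (n + 1) → MvPolynomial (Unknown n μ) K :=
  fun p => diffOp (perturbed μ F) p.1 p.2

/-- The point `(x, b, a)`. -/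
def point (x : Fin (n + 1) → K) (b : Fin (μ - 1) → K) (a : Fin (μ - 1) × Fin n → K) :
    Unknown n μ → K :=
  Sum.elim x (Sum.elim b a)

/-- `(x, b, a)` is a zero of the deflated system. -/
def IsDeflatedZero (F : Fin (n + 1) → MvPolynomial (Fin (n + 1)) K) (x : Fin (n + 1) → K)
    (b : Fin (μ - 1) → K) (a : Fin (μ - 1) × Fin n → K) : Prop :=
  ∀ p, eval (point x b a) (deflated μ F p) = 0

/-- The Jacobian matrix `J_G(x, b, a)` of the deflated system with respect to all its unknowns. -/
def deflatedJacobian (F : Fin (n + 1) → MvPolynomial (Fin (n + 1)) K) (x : Fin (n + 1) → K)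
    (b : Fin (μ - 1) → K) (a : Fin (μ - 1) × Fin n → K) :
    Matrix (Fin μ × Fin (n + 1)) (Unknown n μ) K :=
  Matrix.of fun p u => eval (point x b a) (pderiv u (deflated μ F p))

end Deflation

/-- A matrix whose rows and columns are indexed by possibly different finite types is nonsingular
if it has a two-sided inverse (which forces it to be square). -/
def IsNonsingular {K ι κ : Type*} [Field K] [Fintype ι] [Fintype κ] [DecidableEq ι] [DecidableEq κ]
    (M : Matrix ι κ K) : Prop :=
  ∃ N : Matrix κ ι K, M * N = 1 ∧ N * M = 1

end BreadthOne

end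

/-!
By Taylor's formula, `L_{k+1}(H)` is the coefficient of `T ^ k` in `H(γ(T))` for the generic curve
`γ(T) = x + a_2 T + a_3 T ^ 2 + ⋯` (`diffOp_eq_coeff`): both sides satisfy the recursion obtained by
differentiating with respect to `T`. Hence `G(x̂, 0, a) = 0` says that `F(γ(T))` is divisible by
`T ^ μ` (`isDeflatedZero_iff`), and the product of the Jacobian matrix of `G` with a vector consists of
the coefficients up to `T ^ (μ - 1)` of `J_F(γ(T)) w(T) - β(T) e_1`, where `w` is the variation of
the curve and `β` is an arbitrary polynomial of degree at most `μ - 2`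
(`deflatedJacobian_mulVec`).

*Existence of a zero.* As the last columns of `J_F(x̂)` are independent, Nakayama's lemma shows that
the local algebra `R / Q` is generated by `T = x_1 - x̂_1`, so that it is `K[T] / (T ^ μ)`
(`IsIsolatedRoot.ker_localParameterHom`). The other coordinates, written as polynomials in `T`, are the
parameters sought (`IsIsolatedRoot.exists_curveAt`).

*Regularity.* The last columns of `J_F(γ(T))` together with `e_1` form a matrix that is invertible at
`T = 0`, so that a linear system for it can be solved uniquely modulo any power of `T`
(`X_pow_dvd_of_last_columns`). If a kernel vector had a nonzero first component `s`, comparison with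
the tangent vector `γ'(T)`, which `J_F(γ(T))` annihilates modulo `T ^ (μ - 1)`, would give `β = 0`
and `w = s γ'` modulo `T ^ (μ - 1)`. Integrating `w / s` (in characteristic zero) would prolong `γ`
to a curve on which `F` vanishes to the order `μ + 1`, so that `K[T] / (T ^ (μ + 1))` would be a
quotient of the `μ`-dimensional algebra `R / Q` (`le_multiplicity_of_dvd`). Hence `s = 0`, and then
uniqueness gives `w = 0` and `β = 0`.

The general case follows by exchanges that bring nonzero entries of a right and a left kernel vector
of `J_F(x̂)` into the first position.
-/

open MvPolynomial

noncomputable section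

namespace BreadthOne

/-! ### Taylor expansion along the generic curve -/

/-- The chain rule for a derivation `D` of a `K`-algebra and a polynomial evaluated at elements of
this algebra. -/
theorem derivation_aeval {K σ A : Type*} [CommRing K] [Fintype σ] [CommRing A] [Algebra K A]
    (D : Derivation K A A) (γ : σ → A) (p : MvPolynomial σ K) :
    D (aeval γ p) = ∑ i, aeval γ (pderiv i p) * D (γ i) := by
  classical
  induction p using MvPolynomial.induction_on with
  | C a => simp
  | add p q hp hq => simp [hp, hq, add_mul, Finset.sum_add_distrib]
  | mul_X p j hp =>
    simp only [map_mul, aeval_X, Derivation.leibniz, smul_eq_mul, hp, map_add, add_mul,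
      Finset.sum_add_distrib, Finset.mul_sum, pderiv_X]
    congr 1
    · rw [Finset.sum_eq_single j]
      · simp
      · intro b _ hb; simp [Pi.single_eq_of_ne' hb]
      · simp
    · refine Finset.sum_congr rfl fun i _ => ?_
      ring

/-- The derivation of `S[T]` that applies a derivation of `S` to each coefficient. -/
def coeffDerivation {K S : Type*} [CommRing K] [CommRing S] [Algebra K S] (d : Derivation K S S) :
    Derivation K (Polynomial S) (Polynomial S) :=
  PolynomialModule.equivPolynomialSelf.compDer d.mapCoeffs

@[simp]
theorem coeff_coeffDerivation {K S : Type*} [CommRing K] [CommRing S] [Algebra K S]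
    (d : Derivation K S S) (p : Polynomial S) (k : ℕ) :
    (coeffDerivation d p).coeff k = d (p.coeff k) := rfl

/-- The derivative with respect to `T`, as a `K`-derivation of `S[T]`. -/
def tDerivation (K S : Type*) [CommRing K] [CommRing S] [Algebra K S] :
    Derivation K (Polynomial S) (Polynomial S) :=
  (Polynomial.derivative' (R := S)).restrictScalars K

@[simp]
theorem tDerivation_apply {K S : Type*} [CommRing K] [CommRing S] [Algebra K S]
    (p : Polynomial S) : tDerivation K S p = Polynomial.derivative p := rfl

section GeneratingPolynomial

variable (K : Type*) [Field K] (n μ : ℕ)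

/-- The generic curve `x + a_2 T + a_3 T ^ 2 + ⋯`, with coefficients in the polynomial ring of the
deflated system. The range of summation contains every index `m` with `aVec K n μ m ≠ 0`, also for
`μ ≤ 1`. -/
def curve (j : Fin (n + 1)) : Polynomial (MvPolynomial (Unknown n μ) K) :=
  Polynomial.C (X (xVar n μ j)) +
    ∑ m ∈ Finset.range (μ + 1), Polynomial.C (aVec K n μ m j) * Polynomial.X ^ (m + 1)

/-- The substitution of the generic curve for `x`, which leaves the other unknowns alone. -/
def alongCurve :
    MvPolynomial (Unknown n μ) K →ₐ[K] Polynomial (MvPolynomial (Unknown n μ) K) :=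
  aeval (Sum.elim (curve K n μ) fun u => Polynomial.C (X (Sum.inr u)))

variable {K n μ}

theorem aVec_eq_zero {m : ℕ} (hm : μ < m) : aVec K n μ m = 0 := by
  have h0 : m ≠ 0 := by omega
  have h1 : ¬ m < μ - 1 := by omega
  funext j
  refine Fin.cases ?_ (fun j => ?_) j <;> simp [aVec, h0, h1]

theorem curve_coeff_zero (j : Fin (n + 1)) : (curve K n μ j).coeff 0 = X (xVar n μ j) := by
  simp [curve]

theorem curve_coeff_succ (j : Fin (n + 1)) (k : ℕ) :
    (curve K n μ j).coeff (k + 1) = aVec K n μ k j := by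
  simp only [curve, Polynomial.coeff_add, Polynomial.coeff_C_succ, zero_add,
    Polynomial.finsetSum_coeff, Polynomial.coeff_C_mul_X_pow, add_left_inj]
  rw [Finset.sum_ite_eq]
  split_ifs with h
  · rfl
  · rw [aVec_eq_zero (by simpa using h)]; rfl

theorem alongCurve_rename (p : MvPolynomial (Fin (n + 1)) K) :
    alongCurve K n μ (rename (xVar n μ) p) = aeval (curve K n μ) p := by
  rw [alongCurve, aeval_rename]
  rfl

theorem coeff_zero_alongCurve (p : MvPolynomial (Unknown n μ) K) :
    (alongCurve K n μ p).coeff 0 = p := by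
  have h : ((Polynomial.aeval (0 : MvPolynomial (Unknown n μ) K)).restrictScalars K).comp
      (alongCurve K n μ) = AlgHom.id K _ := by
    refine MvPolynomial.algHom_ext fun u => ?_
    rcases u with j | u
    · simp [alongCurve, ← Polynomial.coeff_zero_eq_eval_zero, curve_coeff_zero, xVar]
    · simp [alongCurve]
  have := DFunLike.congr_fun h p
  simpa [Polynomial.coeff_zero_eq_eval_zero] using this

theorem pderiv_aVec (m : ℕ) (i j : Fin (n + 1)) :
    pderiv (xVar n μ i) (aVec K n μ m j) = 0 := by
  classical
  refine Fin.cases ?_ (fun j => ?_) j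
  · by_cases h : m = 0 <;> simp [aVec, h]
  · by_cases h : m < μ - 1
    · simp [aVec, h, pderiv_X, aVar, xVar]
    · simp [aVec, h]

theorem coeffDerivation_pderiv_curve (i j : Fin (n + 1)) :
    coeffDerivation (pderiv (xVar n μ i)) (curve K n μ j) = if j = i then 1 else 0 := by
  classical
  ext1 k
  rw [coeff_coeffDerivation]
  cases k with
  | zero =>
    rw [curve_coeff_zero, pderiv_X]
    by_cases h : j = i
    · simp [h]
    · have : xVar n μ i ≠ xVar n μ j := fun e => h (Sum.inl_injective e).symm
      simp [h, this]
  | succ k =>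
    rw [curve_coeff_succ, pderiv_aVec]
    split_ifs <;> simp [Polynomial.coeff_one]

/-- Differentiation with respect to `x_i` commutes with the substitution of the generic curve. -/
theorem alongCurve_pderiv (i : Fin (n + 1)) (p : MvPolynomial (Unknown n μ) K) :
    alongCurve K n μ (pderiv (xVar n μ i) p) =
      coeffDerivation (pderiv (xVar n μ i)) (alongCurve K n μ p) := by
  rw [alongCurve, derivation_aeval, Fintype.sum_sum_type, Finset.sum_eq_single i,
    Finset.sum_eq_zero]
  · rw [Sum.elim_inl, coeffDerivation_pderiv_curve]
    simp [xVar]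
  · intro u _
    have : coeffDerivation (pderiv (xVar n μ i))
        (Polynomial.C (X (Sum.inr u) : MvPolynomial (Unknown n μ) K)) = 0 := by
      classical
      ext1 k
      rw [coeff_coeffDerivation, Polynomial.coeff_C]
      split_ifs <;> simp [pderiv_X, xVar]
    simp [this]
  · intro j _ hj
    simp [coeffDerivation_pderiv_curve, hj]
  · simp

/-- The operators `L_k` are the Taylor coefficients along the generic curve: differentiating
`H(γ(T))` with respect to `T` gives the recursion that defines them. -/
theorem diffOp_eq_coeff [CharZero K] (H : Fin (n + 1) → MvPolynomial (Unknown n μ) K) (k : ℕ)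
    (i : Fin (n + 1)) : diffOp H k i = (alongCurve K n μ (H i)).coeff k := by
  induction k using Nat.strong_induction_on generalizing i with
  | _ k ih =>
  cases k with
  | zero => rw [coeff_zero_alongCurve, diffOp]
  | succ k =>
    have hD : Polynomial.derivative (alongCurve K n μ (H i)) =
        ∑ j, alongCurve K n μ (pderiv (xVar n μ j) (H i)) *
          Polynomial.derivative (curve K n μ j) := by
      have := derivation_aeval (tDerivation K (MvPolynomial (Unknown n μ) K))
        (Sum.elim (curve K n μ) fun u => Polynomial.C (X (Sum.inr u))) (H i)
      rw [Fintype.sum_sum_type] at this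
      simpa [alongCurve, xVar] using this
    have hk : (k + 1 : K) ≠ 0 := by exact_mod_cast Nat.succ_ne_zero k
    have hc : (alongCurve K n μ (H i)).coeff (k + 1) * (k + 1) =
        ∑ m ∈ Finset.range (k + 1), ((m : K) + 1) •
          (jacobianX (diffOp H (k - m))).mulVec (aVec K n μ m) i := by
      rw [← Polynomial.coeff_derivative, hD, Polynomial.finsetSum_coeff]
      simp only [mul_comm (alongCurve K n μ _), Polynomial.coeff_mul,
        Finset.Nat.sum_antidiagonal_eq_sum_range_succ_mk, Polynomial.coeff_derivative,
        curve_coeff_succ]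
      rw [Finset.sum_comm]
      refine Finset.sum_congr rfl fun m hm => ?_
      rw [Matrix.mulVec, dotProduct, Finset.smul_sum]
      refine Finset.sum_congr rfl fun j _ => ?_
      rw [alongCurve_pderiv, coeff_coeffDerivation, ← ih (k - m) (by omega), jacobianX,
        Matrix.of_apply, smul_eq_C_mul]
      simp only [map_add, map_natCast, map_one]
      ring
    have hc' : (alongCurve K n μ (H i)).coeff (k + 1) = ((k : K) + 1)⁻¹ •
        ∑ m ∈ Finset.range (k + 1), ((m : K) + 1) •
          (jacobianX (diffOp H (k - m))).mulVec (aVec K n μ m) i := by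
      rw [← hc, eq_inv_smul_iff₀ hk, smul_eq_C_mul]
      simp only [map_add, map_natCast, map_one]
      ring
    rw [hc', Finset.sum_range_succ, smul_add, smul_smul, inv_mul_cancel₀ hk, one_smul, diffOp,
      Nat.sub_self, Finset.smul_sum, Finset.sum_range]
    simp only [Pi.add_apply, Finset.sum_apply, Pi.smul_apply, smul_smul, div_eq_inv_mul]
    congr 2
    simp [diffOp]

end GeneratingPolynomial

/-! ### Values and Jacobian matrix of the deflated system -/

section Specialization

variable {K : Type*} [Field K] {n μ : ℕ}

/-- The curve `x + a_2 T + a_3 T ^ 2 + ⋯` for given values of `x` and of the parameters `a`. -/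
def curveAt (x : Fin (n + 1) → K) (a : Fin (μ - 1) × Fin n → K) : Fin (n + 1) → Polynomial K :=
  Fin.cons (Polynomial.C (x 0) + Polynomial.X) fun j =>
    Polynomial.C (x j.succ) +
      ∑ m : Fin (μ - 1), Polynomial.C (a (m, j)) * Polynomial.X ^ ((m : ℕ) + 1)

/-- The derivative of the curve `x + a_2 T + a_3 T ^ 2 + ⋯` in the direction `v` of the space of the
unknowns. -/
def curveVariation (v : Unknown n μ → K) : Fin (n + 1) → Polynomial K :=
  Fin.cons (Polynomial.C (v (xVar n μ 0))) fun j =>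
    Polynomial.C (v (xVar n μ j.succ)) +
      ∑ m : Fin (μ - 1), Polynomial.C (v (aVar n μ m j)) * Polynomial.X ^ ((m : ℕ) + 1)

theorem coeff_succ_sum_fin {N : ℕ} (c : Fin N → K) (k : ℕ) :
    (∑ m, Polynomial.C (c m) * Polynomial.X ^ ((m : ℕ) + 1)).coeff (k + 1) =
      if h : k < N then c ⟨k, h⟩ else 0 := by
  simp only [Polynomial.finsetSum_coeff, Polynomial.coeff_C_mul_X_pow, add_left_inj]
  split_ifs with h
  · rw [Finset.sum_eq_single ⟨k, h⟩]
    · simp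
    · intro m _ hm
      rw [if_neg]
      exact fun e => hm (Fin.ext e.symm)
    · simp
  · refine Finset.sum_eq_zero fun m _ => if_neg ?_
    have := m.2
    omega

theorem coeff_zero_sum_fin {N : ℕ} (c : Fin N → K) :
    (∑ m, Polynomial.C (c m) * Polynomial.X ^ ((m : ℕ) + 1)).coeff 0 = 0 := by
  simp [Polynomial.finsetSum_coeff]

theorem map_curve (x : Fin (n + 1) → K) (b : Fin (μ - 1) → K) (a : Fin (μ - 1) × Fin n → K)
    (j : Fin (n + 1)) :
    (curve K n μ j).map (eval (point x b a)) = curveAt x a j := by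
  ext k
  rw [Polynomial.coeff_map]
  cases k with
  | zero =>
    rw [curve_coeff_zero, eval_X]
    refine Fin.cases ?_ (fun j => ?_) j
    · simp [curveAt, point, xVar]
    · simp only [curveAt, Fin.cons_succ, Polynomial.coeff_add, coeff_zero_sum_fin]
      simp [point, xVar]
  | succ k =>
    rw [curve_coeff_succ]
    refine Fin.cases ?_ (fun j => ?_) j
    · by_cases h : k = 0 <;> simp [curveAt, aVec, h, Polynomial.coeff_X]
    · simp only [curveAt, Fin.cons_succ, Polynomial.coeff_add, Polynomial.coeff_C_succ, zero_add,
        coeff_succ_sum_fin, aVec]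
      split_ifs <;> simp [point, aVar]

/-- The derivation of the polynomial ring in the direction `v`. -/
def directionalDerivation (v : Unknown n μ → K) :
    Derivation K (MvPolynomial (Unknown n μ) K) (MvPolynomial (Unknown n μ) K) :=
  mkDerivation K fun u => C (v u)

@[simp]
theorem directionalDerivation_X (v : Unknown n μ → K) (u : Unknown n μ) :
    directionalDerivation v (X u) = C (v u) := mkDerivation_X _ _ _

theorem directionalDerivation_eq_sum (v : Unknown n μ → K) (p : MvPolynomial (Unknown n μ) K) :
    directionalDerivation v p = ∑ u, pderiv u p * C (v u) := by
  have := derivation_aeval (directionalDerivation v) X p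
  simpa [aeval_X_left] using this

theorem map_coeffDerivation_curve (x : Fin (n + 1) → K) (b : Fin (μ - 1) → K)
    (a : Fin (μ - 1) × Fin n → K) (v : Unknown n μ → K) (j : Fin (n + 1)) :
    (coeffDerivation (directionalDerivation v) (curve K n μ j)).map (eval (point x b a)) =
      curveVariation v j := by
  ext k
  rw [Polynomial.coeff_map, coeff_coeffDerivation]
  cases k with
  | zero =>
    rw [curve_coeff_zero, directionalDerivation_X, eval_C]
    refine Fin.cases ?_ (fun j => ?_) j
    · simp [curveVariation]
    · simp only [curveVariation, Fin.cons_succ, Polynomial.coeff_add, coeff_zero_sum_fin]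
      simp
  | succ k =>
    rw [curve_coeff_succ]
    refine Fin.cases ?_ (fun j => ?_) j
    · by_cases h : k = 0 <;> simp [curveVariation, aVec, h]
    · simp only [curveVariation, Fin.cons_succ, Polynomial.coeff_add, Polynomial.coeff_C_succ,
        zero_add, coeff_succ_sum_fin, aVec]
      split_ifs <;> simp

theorem map_aeval_curve (x : Fin (n + 1) → K) (b : Fin (μ - 1) → K)
    (a : Fin (μ - 1) × Fin n → K) (p : MvPolynomial (Fin (n + 1)) K) :
    (aeval (curve K n μ) p).map (eval (point x b a)) = aeval (curveAt x a) p := by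
  have h : (Polynomial.mapAlgHom (aeval (point x b a))).comp (aeval (curve K n μ)) =
      aeval (curveAt x a) := by
    refine MvPolynomial.algHom_ext fun j => ?_
    simp only [AlgHom.comp_apply, aeval_X, ← map_curve x b a]
    rfl
  exact DFunLike.congr_fun h p

theorem alongCurve_perturbed (F : Fin (n + 1) → MvPolynomial (Fin (n + 1)) K) (i : Fin (n + 1)) :
    alongCurve K n μ (perturbed μ F i) = aeval (curve K n μ) (F i) -
      (∑ ν : Fin (μ - 1), Polynomial.C (C (((ν : ℕ).factorial : K)⁻¹)) *
        Polynomial.C (X (bVar n μ ν)) * curve K n μ 0 ^ (ν : ℕ)) * (if i = 0 then 1 else 0) := by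
  have hC (c : K) : alongCurve K n μ (C c) = Polynomial.C (C c) :=
    (alongCurve K n μ).commutes c
  have hb (ν : Fin (μ - 1)) : alongCurve K n μ (X (bVar n μ ν)) = Polynomial.C (X (bVar n μ ν)) :=
    aeval_X _ _
  have hx : alongCurve K n μ (X (xVar n μ 0)) = curve K n μ 0 := aeval_X _ _
  have hi : alongCurve K n μ (if i = 0 then 1 else 0) = if i = 0 then 1 else 0 := by
    split_ifs
    · exact map_one _
    · exact map_zero _
  simp only [perturbed, map_sub, map_mul, map_sum, map_pow, alongCurve_rename, hC, hb, hx, hi]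

theorem isDeflatedZero_iff [CharZero K] (F : Fin (n + 1) → MvPolynomial (Fin (n + 1)) K)
    (x : Fin (n + 1) → K) (a : Fin (μ - 1) × Fin n → K) :
    IsDeflatedZero F x 0 a ↔ ∀ i, Polynomial.X ^ μ ∣ aeval (curveAt x a) (F i) := by
  have key (p : Fin μ × Fin (n + 1)) : eval (point x 0 a) (deflated μ F p) =
      (aeval (curveAt x a) (F p.2)).coeff p.1 := by
    rw [deflated, diffOp_eq_coeff, ← Polynomial.coeff_map, alongCurve_perturbed,
      Polynomial.map_sub, map_aeval_curve, Polynomial.map_mul, Polynomial.map_sum,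
      Finset.sum_eq_zero, zero_mul, sub_zero]
    intro ν _
    simp [bVar, point]
  simp only [IsDeflatedZero, key, Polynomial.X_pow_dvd_iff]
  exact ⟨fun h i d hd => h (⟨d, hd⟩, i), fun h p => h p.2 p.1 p.1.2⟩

/-- The product of the Jacobian matrix of the deflated system with a vector `v`, as a coefficient of
the linearization of `F` along the curve. -/
theorem deflatedJacobian_mulVec [CharZero K] (F : Fin (n + 1) → MvPolynomial (Fin (n + 1)) K)
    (x : Fin (n + 1) → K) (a : Fin (μ - 1) × Fin n → K) (v : Unknown n μ → K)
    (p : Fin μ × Fin (n + 1)) :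
    (deflatedJacobian F x 0 a).mulVec v p =
      (∑ j, aeval (curveAt x a) (pderiv j (F p.2)) * curveVariation v j -
        (∑ ν : Fin (μ - 1), Polynomial.C (((ν : ℕ).factorial : K)⁻¹ * v (bVar n μ ν)) *
          (Polynomial.X + Polynomial.C (x 0)) ^ (ν : ℕ)) *
            (if p.2 = 0 then 1 else 0)).coeff p.1 := by
  have h1 : (deflatedJacobian F x 0 a).mulVec v p =
      eval (point x 0 a) (directionalDerivation v (deflated μ F p)) := by
    simp [directionalDerivation_eq_sum, Matrix.mulVec, dotProduct, deflatedJacobian]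
  rw [h1, deflated, diffOp_eq_coeff, ← coeff_coeffDerivation, ← Polynomial.coeff_map,
    alongCurve_perturbed, map_sub, Polynomial.map_sub, derivation_aeval, Polynomial.map_sum]
  simp only [Polynomial.map_mul, map_aeval_curve, map_coeffDerivation_curve]
  have h2 : (coeffDerivation (directionalDerivation v)
      ((∑ ν : Fin (μ - 1), Polynomial.C (C (((ν : ℕ).factorial : K)⁻¹)) *
        Polynomial.C (X (bVar n μ ν)) * curve K n μ 0 ^ (ν : ℕ)) *
          (if p.2 = 0 then 1 else 0))).map (eval (point x 0 a)) =
      (∑ ν : Fin (μ - 1), Polynomial.C (((ν : ℕ).factorial : K)⁻¹ * v (bVar n μ ν)) *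
          (Polynomial.X + Polynomial.C (x 0)) ^ (ν : ℕ)) * (if p.2 = 0 then 1 else 0) := by
    split_ifs
    · simp only [mul_one, map_sum, Polynomial.map_sum]
      refine Finset.sum_congr rfl fun ν _ => ?_
      have hC (q : MvPolynomial (Unknown n μ) K) :
          coeffDerivation (directionalDerivation v) (Polynomial.C q) =
            Polynomial.C (directionalDerivation v q) := by
        ext1 k
        rw [coeff_coeffDerivation, Polynomial.coeff_C, Polynomial.coeff_C]
        split_ifs <;> simp
      have hc : directionalDerivation v (C (((ν : ℕ).factorial : K)⁻¹)) = 0 :=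
        (directionalDerivation v).map_algebraMap _
      -- The terms in which `b_ν` is not differentiated vanish, as `b = 0`.
      have hb : eval (point x 0 a) (X (bVar n μ ν)) = 0 := by simp [bVar, point]
      have hx : (curve K n μ 0).map (eval (point x 0 a)) = Polynomial.X + Polynomial.C (x 0) := by
        rw [map_curve, curveAt, Fin.cons_zero, add_comm]
      simp only [Derivation.leibniz, smul_eq_mul, hC, hc, directionalDerivation_X,
        Polynomial.map_add, Polynomial.map_mul, Polynomial.map_pow, Polynomial.map_C, hb, hx,
        map_zero, map_mul, eval_C]
      ring
    · simp
  rw [h2]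

end Specialization

/-! ### The local algebra of the root -/

section LocalAlgebra

variable {K : Type*} [Field K] {n : ℕ} {F : Fin (n + 1) → MvPolynomial (Fin (n + 1)) K}
  {x : Fin (n + 1) → K}

theorem mem_vanishingIdeal_singleton {p : MvPolynomial (Fin (n + 1)) K} :
    p ∈ vanishingIdeal K {x} ↔ eval x p = 0 := by
  rw [mem_vanishingIdeal_singleton_iff, aeval_eq_eval]

theorem mem_primaryComponent_iff {q : MvPolynomial (Fin (n + 1)) K} :
    q ∈ primaryComponent F x ↔ ∃ s, eval x s ≠ 0 ∧ s * q ∈ systemIdeal F := by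
  rw [primaryComponent, Ideal.mem_comap,
    IsLocalization.algebraMap_mem_map_algebraMap_iff (vanishingIdeal K {x}).primeCompl]
  simp only [Ideal.primeCompl, Submonoid.mem_mk, Subsemigroup.mem_mk, Set.mem_compl_iff,
    SetLike.mem_coe, mem_vanishingIdeal_singleton, ne_eq]

theorem systemIdeal_le_primaryComponent : systemIdeal F ≤ primaryComponent F x :=
  Ideal.le_comap_map

theorem mem_systemIdeal (i : Fin (n + 1)) : F i ∈ systemIdeal F :=
  Ideal.subset_span ⟨i, rfl⟩

theorem IsIsolatedRoot.eval_eq_zero_of_mem_systemIdeal (h : IsIsolatedRoot F x)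
    {p : MvPolynomial (Fin (n + 1)) K} (hp : p ∈ systemIdeal F) : eval x p = 0 :=
  mem_vanishingIdeal_singleton.1 (h.1.2 hp)

theorem IsIsolatedRoot.primaryComponent_le (h : IsIsolatedRoot F x) :
    primaryComponent F x ≤ vanishingIdeal K {x} := by
  intro q hq
  obtain ⟨s, hs, hsq⟩ := mem_primaryComponent_iff.1 hq
  have := h.eval_eq_zero_of_mem_systemIdeal hsq
  rw [map_mul] at this
  exact mem_vanishingIdeal_singleton.2 ((mul_eq_zero.1 this).resolve_left hs)

/-- By minimality of the ideal of the point, the extension of the ideal of the system to the local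
ring has the maximal ideal as its radical. -/
theorem IsIsolatedRoot.exists_pow_mem (h : IsIsolatedRoot F x)
    {p : MvPolynomial (Fin (n + 1)) K} (hp : eval x p = 0) :
    ∃ N : ℕ, p ^ N ∈ primaryComponent F x := by
  have hr := IsLocalization.AtPrime.radical_map_of_mem_minimalPrimes
    (A := Localization.AtPrime (vanishingIdeal K {x})) _ _ h
  have hm := Ideal.mem_map_of_mem
    (algebraMap _ (Localization.AtPrime (vanishingIdeal K {x})))
    ((mem_vanishingIdeal_singleton (x := x)).2 hp)
  rw [← hr] at hm
  obtain ⟨N, hN⟩ := hm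
  exact ⟨N, by rwa [primaryComponent, Ideal.mem_comap, map_pow]⟩

/-- The first-order Taylor expansion at `x`. -/
theorem taylor_sub_mem (x : Fin (n + 1) → K) (p : MvPolynomial (Fin (n + 1)) K) :
    p - (C (eval x p) + ∑ j, C (eval x (pderiv j p)) * (X j - C (x j))) ∈
      vanishingIdeal K {x} ^ 2 := by
  classical
  have hX (j : Fin (n + 1)) : (X j - C (x j) : MvPolynomial (Fin (n + 1)) K) ∈
      vanishingIdeal K {x} := mem_vanishingIdeal_singleton.2 (by simp)
  induction p using MvPolynomial.induction_on with
  | C a => simp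
  | add p q hp hq =>
    convert! add_mem hp hq using 1
    simp only [map_add, add_mul, Finset.sum_add_distrib]
    ring
  | mul_X p k hp =>
    have h1 : (∑ j, C (eval x (pderiv j p)) * (X j - C (x j))) * (X k - C (x k)) ∈
        vanishingIdeal K {x} ^ 2 := by
      rw [sq]
      exact Ideal.mul_mem_mul (Ideal.sum_mem _ fun j _ => Ideal.mul_mem_left _ _ (hX j)) (hX k)
    have h2 : ∑ j, C (eval x (pderiv j (p * X k))) * (X j - C (x j)) =
        C (eval x p) * (X k - C (x k)) +
          (∑ j, C (eval x (pderiv j p)) * (X j - C (x j))) * C (x k) := by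
      simp only [Derivation.leibniz, smul_eq_mul, map_add, map_mul, eval_X, add_mul,
        Finset.sum_add_distrib, Finset.sum_mul, pderiv_X]
      congr 1
      · rw [Finset.sum_eq_single k]
        · simp
        · intro j _ hj
          simp [Pi.single_eq_of_ne' hj]
        · simp
      · exact Finset.sum_congr rfl fun j _ => by ring
    rw [h2]
    convert! add_mem (Ideal.mul_mem_right (X k) _ hp) h1 using 1
    simp only [map_mul, eval_X]
    ring

variable (F x) in
/-- The homomorphism from `K[T]` to the local algebra of the root that sends `T` to the class of
`x_1 - x̂_1`. -/
def localParameterHom :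
    Polynomial K →ₐ[K] MvPolynomial (Fin (n + 1)) K ⧸ primaryComponent F x :=
  Polynomial.aeval (Ideal.Quotient.mk _ (X 0 - C (x 0)))

@[simp]
theorem localParameterHom_X : localParameterHom F x Polynomial.X =
    Ideal.Quotient.mk (primaryComponent F x) (X 0 - C (x 0)) := Polynomial.aeval_X _

@[simp]
theorem localParameterHom_C (c : K) : localParameterHom F x (Polynomial.C c) =
    Ideal.Quotient.mk (primaryComponent F x) (C c) := (localParameterHom F x).commutes c

/-- If the last `n` columns of the Jacobian matrix are linearly independent, then `x_1 - x̂_1`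
generates the maximal ideal of the local algebra: the linear parts of the equations express the other
coordinates in terms of it modulo the square of the maximal ideal, and Nakayama's lemma applies as
this ideal is nilpotent. -/
theorem IsIsolatedRoot.exists_eq_mul (h : IsIsolatedRoot F x)
    (hJ : ∃ W : Matrix (Fin n) (Fin (n + 1)) K, W * lastColumns F x = 1)
    {p : MvPolynomial (Fin (n + 1)) K} (hp : eval x p = 0) :
    ∃ b, Ideal.Quotient.mk (primaryComponent F x) p =
      Ideal.Quotient.mk (primaryComponent F x) (X 0 - C (x 0)) * b := by
  obtain ⟨W, hW⟩ := hJ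
  set Q := primaryComponent F x
  set m : Ideal (MvPolynomial (Fin (n + 1)) K) := vanishingIdeal K {x}
  set N : Ideal (MvPolynomial (Fin (n + 1)) K) := (Ideal.span {X 0 - C (x 0)} ⊔ Q) ⊔ m ^ 2 with hN
  have hX0 : X 0 - C (x 0) ∈ N :=
    Ideal.mem_sup_left (Ideal.mem_sup_left (Ideal.mem_span_singleton_self _))
  have hQN : Q ≤ N := le_sup_right.trans le_sup_left
  have hmN : m ^ 2 ≤ N := le_sup_right
  have hrow (i : Fin (n + 1)) :
      ∑ j : Fin n, C (lastColumns F x i j) * (X j.succ - C (x j.succ)) ∈ N := by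
    have h1 := hmN (taylor_sub_mem x (F i))
    have h2 : F i ∈ N := hQN (systemIdeal_le_primaryComponent (mem_systemIdeal i))
    rw [h.eval_eq_zero_of_mem_systemIdeal (mem_systemIdeal i), map_zero, zero_add,
      Fin.sum_univ_succ] at h1
    have h3 := N.sub_mem h2 h1
    rw [sub_sub_cancel] at h3
    exact (Ideal.add_mem_iff_right _ (Ideal.mul_mem_left _ _ hX0)).1 h3
  have hcoord (j : Fin (n + 1)) : X j - C (x j) ∈ N := by
    refine Fin.cases hX0 (fun k => ?_) j
    have h1 : ∑ i, C (W k i) * ∑ j : Fin n, C (lastColumns F x i j) * (X j.succ - C (x j.succ)) =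
        X k.succ - C (x k.succ) := by
      simp only [Finset.mul_sum]
      rw [Finset.sum_comm]
      simp only [← mul_assoc, ← Finset.sum_mul, ← map_mul, ← map_sum, ← Matrix.mul_apply, hW]
      rw [Finset.sum_eq_single k]
      · simp
      · intro j _ hj
        simp [Matrix.one_apply_ne' hj]
      · simp
    rw [← h1]
    exact Ideal.sum_mem _ fun i _ => Ideal.mul_mem_left _ _ (hrow i)
  have hmle : m ≤ N := by
    intro p hp
    have h1 := hmN (taylor_sub_mem x p)
    rw [mem_vanishingIdeal_singleton.1 hp, map_zero, zero_add] at h1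
    rw [← sub_add_cancel p (∑ j, C (eval x (pderiv j p)) * (X j - C (x j)))]
    exact N.add_mem h1 (N.sum_mem fun j _ => N.mul_mem_left _ (hcoord j))
  set π := Ideal.Quotient.mk Q
  have hmap : m.map π ≤ Ideal.span {π (X 0 - C (x 0))} ⊔ m.map π • m.map π := by
    have := Ideal.map_mono (f := π) hmle
    rwa [hN, Ideal.map_sup, Ideal.map_sup, Ideal.map_span, Set.image_singleton,
      Ideal.map_quotient_self, sup_bot_eq, Ideal.map_pow, sq, ← smul_eq_mul] at this
  have hjac : m.map π ≤ Ideal.jacobson ⊥ := by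
    rw [Ideal.map_le_iff_le_comap]
    intro q hq
    obtain ⟨k, hk⟩ := h.exists_pow_mem (mem_vanishingIdeal_singleton.1 hq)
    refine Ideal.radical_le_jacobson ⟨k, ?_⟩
    rw [← map_pow]
    exact Ideal.Quotient.eq_zero_iff_mem.2 hk
  have := Submodule.le_of_le_smul_of_le_jacobson_bot (IsNoetherian.noetherian (m.map π)) hjac hmap
  have hpm := this (Ideal.mem_map_of_mem π (mem_vanishingIdeal_singleton.2 hp))
  obtain ⟨b, hb⟩ := Ideal.mem_span_singleton'.1 hpm
  exact ⟨b, by rw [← hb, mul_comm]⟩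

theorem IsIsolatedRoot.localParameterHom_surjective (h : IsIsolatedRoot F x)
    (hJ : ∃ W : Matrix (Fin n) (Fin (n + 1)) K, W * lastColumns F x = 1) :
    Function.Surjective (localParameterHom F x) := by
  -- Every element is a polynomial in the local parameter modulo its `N`-th power, for every `N`.
  have step (N : ℕ) (b : MvPolynomial (Fin (n + 1)) K ⧸ primaryComponent F x) :
      ∃ g b', b = localParameterHom F x g +
        Ideal.Quotient.mk (primaryComponent F x) (X 0 - C (x 0)) ^ N * b' := by
    induction N with
    | zero => exact ⟨0, b, by simp⟩
    | succ N ih =>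
      obtain ⟨g, b', hb⟩ := ih
      obtain ⟨p, rfl⟩ := Ideal.Quotient.mk_surjective b'
      obtain ⟨c, hc⟩ := h.exists_eq_mul hJ (p := p - C (eval x p)) (by simp)
      refine ⟨g + Polynomial.X ^ N * Polynomial.C (eval x p), c, ?_⟩
      rw [hb, map_add, map_mul, map_pow, localParameterHom_C, localParameterHom_X]
      rw [map_sub] at hc
      linear_combination Ideal.Quotient.mk (primaryComponent F x) (X 0 - C (x 0)) ^ N * hc
  intro b
  obtain ⟨N, hN⟩ := h.exists_pow_mem (p := X 0 - C (x 0)) (by simp)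
  obtain ⟨g, b', hb⟩ := step N b
  rw [← map_pow, Ideal.Quotient.eq_zero_iff_mem.2 hN, zero_mul, add_zero] at hb
  exact ⟨g, hb.symm⟩

/-- The local algebra of the root is `K[T] / (T ^ μ)`. -/
theorem IsIsolatedRoot.ker_localParameterHom (h : IsIsolatedRoot F x)
    (hJ : ∃ W : Matrix (Fin n) (Fin (n + 1)) K, W * lastColumns F x = 1) :
    RingHom.ker (localParameterHom F x) = Ideal.span {Polynomial.X ^ multiplicity F x} := by
  obtain ⟨N, hN⟩ := h.exists_pow_mem (p := X 0 - C (x 0)) (by simp)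
  obtain ⟨g, hg⟩ := IsPrincipalIdealRing.principal (RingHom.ker (localParameterHom F x))
  have hgN : g ∣ Polynomial.X ^ N := by
    have : (Polynomial.X ^ N : Polynomial K) ∈ RingHom.ker (localParameterHom F x) := by
      rw [RingHom.mem_ker, map_pow, localParameterHom_X, ← map_pow]
      exact Ideal.Quotient.eq_zero_iff_mem.2 hN
    rw [hg] at this
    exact Ideal.mem_span_singleton.1 this
  obtain ⟨r, -, hr⟩ := (dvd_prime_pow Polynomial.prime_X N).1 hgN
  have hker : RingHom.ker (localParameterHom F x) = Ideal.span {Polynomial.X ^ r} := by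
    rw [hg]
    exact Ideal.span_singleton_eq_span_singleton.2 hr
  have e := Ideal.quotientKerAlgEquivOfSurjective (h.localParameterHom_surjective hJ)
  have hfin := ((Ideal.quotientEquivAlgOfEq K hker.symm).trans e).toLinearEquiv.finrank_eq
  rw [finrank_quotient_span_eq_natDegree, Polynomial.natDegree_X_pow] at hfin
  rw [hker, hfin, multiplicity]

theorem IsIsolatedRoot.finite_localAlgebra (h : IsIsolatedRoot F x)
    (hJ : ∃ W : Matrix (Fin n) (Fin (n + 1)) K, W * lastColumns F x = 1) :
    Module.Finite K (MvPolynomial (Fin (n + 1)) K ⧸ primaryComponent F x) := by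
  have e := Ideal.quotientKerAlgEquivOfSurjective (h.localParameterHom_surjective hJ)
  have := (Polynomial.monic_X_pow (R := K) (multiplicity F x)).finite_quotient
  exact Module.Finite.equiv
    ((Ideal.quotientEquivAlgOfEq K (h.ker_localParameterHom hJ).symm).trans e).toLinearEquiv

theorem IsIsolatedRoot.multiplicity_pos (h : IsIsolatedRoot F x)
    (hJ : ∃ W : Matrix (Fin n) (Fin (n + 1)) K, W * lastColumns F x = 1) :
    0 < multiplicity F x := by
  have := h.finite_localAlgebra hJ
  have : Nontrivial (MvPolynomial (Fin (n + 1)) K ⧸ primaryComponent F x) := by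
    refine Ideal.Quotient.nontrivial_iff.2 fun htop => ?_
    have h1 : (1 : MvPolynomial (Fin (n + 1)) K) ∈ primaryComponent F x := htop ▸ trivial
    simpa using mem_vanishingIdeal_singleton.1 (h.primaryComponent_le h1)
  exact Module.finrank_pos

/-- The coordinates of the root, expressed as polynomials in the local parameter, form a curve on
which the system vanishes to the order `μ`. -/
theorem IsIsolatedRoot.exists_curveAt {μ : ℕ} (h : IsIsolatedRoot F x)
    (hJ : ∃ W : Matrix (Fin n) (Fin (n + 1)) K, W * lastColumns F x = 1)
    (hμ : multiplicity F x = μ) :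
    ∃ a : Fin (μ - 1) × Fin n → K, ∀ i, Polynomial.X ^ μ ∣ aeval (curveAt x a) (F i) := by
  have hcoord (j : Fin n) : ∃ g : Polynomial K,
      localParameterHom F x (Polynomial.C (x j.succ) + Polynomial.X * g) =
        Ideal.Quotient.mk (primaryComponent F x) (X j.succ) := by
    obtain ⟨b, hb⟩ := h.exists_eq_mul hJ (p := X j.succ - C (x j.succ)) (by simp)
    obtain ⟨g, rfl⟩ := h.localParameterHom_surjective hJ b
    refine ⟨g, ?_⟩
    rw [map_add, map_mul, localParameterHom_C, localParameterHom_X, ← hb, map_sub]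
    ring
  choose g hg using hcoord
  have hker (p : Polynomial K) : localParameterHom F x p = 0 ↔ Polynomial.X ^ μ ∣ p := by
    rw [← hμ, ← Ideal.mem_span_singleton, ← h.ker_localParameterHom hJ, RingHom.mem_ker]
  refine ⟨fun q => (g q.2).coeff q.1, fun i => ?_⟩
  set a : Fin (μ - 1) × Fin n → K := fun q => (g q.2).coeff q.1
  have hcurve (j : Fin (n + 1)) :
      localParameterHom F x (curveAt x a j) = Ideal.Quotient.mk (primaryComponent F x) (X j) := by
    refine Fin.cases ?_ (fun j => ?_) j
    · rw [curveAt, Fin.cons_zero, map_add, localParameterHom_C, localParameterHom_X, map_sub]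
      ring
    · rw [← hg, ← sub_eq_zero, ← map_sub, hker, Polynomial.X_pow_dvd_iff]
      intro d hd
      simp only [curveAt, Fin.cons_succ, add_sub_add_left_eq_sub, Polynomial.coeff_sub]
      cases d with
      | zero => rw [coeff_zero_sum_fin]; simp
      | succ d =>
        rw [coeff_succ_sum_fin, dif_pos (by omega), Polynomial.coeff_X_mul, sub_self]
  have hF : (localParameterHom F x).comp (aeval (curveAt x a)) =
      Ideal.Quotient.mkₐ K (primaryComponent F x) := by
    refine MvPolynomial.algHom_ext fun j => ?_
    rw [AlgHom.comp_apply, aeval_X, hcurve]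
    rfl
  rw [← hker]
  exact (DFunLike.congr_fun hF (F i)).trans
    (Ideal.Quotient.eq_zero_iff_mem.2 (systemIdeal_le_primaryComponent (mem_systemIdeal i)))

theorem coeff_zero_aeval {γ : Fin (n + 1) → Polynomial K} (hγ : ∀ j, (γ j).coeff 0 = x j)
    (p : MvPolynomial (Fin (n + 1)) K) : (aeval γ p).coeff 0 = eval x p := by
  have h : (Polynomial.aeval (0 : K)).comp (aeval γ) = aeval x := by
    refine MvPolynomial.algHom_ext fun j => ?_
    rw [AlgHom.comp_apply, aeval_X, aeval_X, ← Polynomial.coeff_zero_eq_aeval_zero, hγ]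
  rw [Polynomial.coeff_zero_eq_aeval_zero, ← aeval_eq_eval]
  exact DFunLike.congr_fun h p

/-- The order of vanishing of the system along a curve through the root whose first coordinate is
`x̂_1 + T` is at most the multiplicity, because such a curve exhibits `K[T] / (T ^ r)` as a quotient
of the local algebra. -/
theorem le_multiplicity_of_dvd [Module.Finite K
      (MvPolynomial (Fin (n + 1)) K ⧸ primaryComponent F x)] {r : ℕ}
    {γ : Fin (n + 1) → Polynomial K} (hγ : ∀ j, (γ j).coeff 0 = x j)
    (hγ0 : γ 0 = Polynomial.C (x 0) + Polynomial.X)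
    (hF : ∀ i, Polynomial.X ^ r ∣ aeval γ (F i)) : r ≤ multiplicity F x := by
  set I : Ideal (Polynomial K) := Ideal.span {Polynomial.X ^ r} with hI
  have hsys : systemIdeal F ≤ I.comap (aeval γ : MvPolynomial (Fin (n + 1)) K →ₐ[K] _) := by
    refine Ideal.span_le.2 ?_
    rintro _ ⟨i, rfl⟩
    exact Ideal.mem_span_singleton.2 (hF i)
  have hprim (q) (hq : q ∈ primaryComponent F x) :
      (Ideal.Quotient.mkₐ K I).comp (aeval γ) q = 0 := by
    obtain ⟨s, hs, hsq⟩ := mem_primaryComponent_iff.1 hq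
    have h1 : Polynomial.X ^ r ∣ aeval γ s * aeval γ q := by
      rw [← map_mul]
      exact Ideal.mem_span_singleton.1 (hsys hsq)
    refine Ideal.Quotient.eq_zero_iff_mem.2 (Ideal.mem_span_singleton.2 ?_)
    refine Polynomial.prime_X.pow_dvd_of_dvd_mul_left r (fun hX => hs ?_) h1
    rw [← coeff_zero_aeval hγ]
    exact Polynomial.X_dvd_iff.1 hX
  let ψ := Ideal.Quotient.liftₐ (primaryComponent F x) _ hprim
  have hψ : Function.Surjective ψ := by
    intro b
    obtain ⟨g, rfl⟩ := Ideal.Quotient.mk_surjective b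
    refine ⟨localParameterHom F x g, ?_⟩
    have : ψ.comp (localParameterHom F x) = Ideal.Quotient.mkₐ K I := by
      refine Polynomial.algHom_ext ?_
      rw [AlgHom.comp_apply, localParameterHom, Polynomial.aeval_X]
      change Ideal.Quotient.mk I (aeval γ (X 0 - C (x 0))) = Ideal.Quotient.mk I Polynomial.X
      rw [map_sub, aeval_X, hγ0, aeval_C, Polynomial.algebraMap_eq, add_sub_cancel_left]
    exact DFunLike.congr_fun this g
  have := LinearMap.finrank_le_finrank_of_surjective (f := ψ.toLinearMap) hψ
  rwa [hI, finrank_quotient_span_eq_natDegree, Polynomial.natDegree_X_pow] at this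

end LocalAlgebra

/-! ### Linear algebra over `K` and `K[T]` -/

section Matrices

variable {K : Type*} [Field K] {n : ℕ}

theorem exists_leftInverse_of_mulVec_eq_zero {ι κ : Type*} [Fintype ι] [Fintype κ] [DecidableEq ι]
    [DecidableEq κ] {M : Matrix ι κ K} (hM : ∀ v, M.mulVec v = 0 → v = 0) :
    ∃ N : Matrix κ ι K, N * M = 1 := by
  obtain ⟨g, hg⟩ := M.mulVecLin.exists_leftInverse_of_injective (LinearMap.ker_eq_bot'.2 hM)
  refine ⟨LinearMap.toMatrix' g, ?_⟩
  rw [← Matrix.toLin'_apply'] at hg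
  rw [← LinearMap.toMatrix'_id, ← hg, LinearMap.toMatrix'_comp, LinearMap.toMatrix'_toLin']

/-- For a matrix of corank one whose first row and first column depend on the other ones, the last
columns together with `e_1` are linearly independent: the row relation is a linear form that vanishes
on the columns but not on `e_1`. -/
theorem FirstRowColDependent.eq_zero_of_mulVec_add {M : Matrix (Fin (n + 1)) (Fin (n + 1)) K}
    (h : FirstRowColDependent M) (hM : M.rank + 1 = n + 1) {w : Fin n → K} {c : K}
    (hw : (M.submatrix id Fin.succ).mulVec w + Pi.single 0 c = 0) : w = 0 ∧ c = 0 := by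
  obtain ⟨hcol, hrow⟩ := h
  obtain ⟨u, hu⟩ := (Submodule.mem_span_range_iff_exists_fun K).1 hrow
  have hsucc (i : Fin n) : (M.submatrix id Fin.succ).mulVec w i.succ = 0 := by
    simpa using congrFun hw i.succ
  have hzero : (M.submatrix id Fin.succ).mulVec w 0 = 0 := by
    have : (M.submatrix id Fin.succ).mulVec w 0 =
        ∑ i, u i * (M.submatrix id Fin.succ).mulVec w i.succ := by
      simp only [Matrix.mulVec, dotProduct, Matrix.submatrix_apply, id_eq, Finset.mul_sum]
      rw [Finset.sum_comm]
      refine Finset.sum_congr rfl fun j _ => ?_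
      rw [← congrFun hu j.succ, Finset.sum_apply, Finset.sum_mul]
      exact Finset.sum_congr rfl fun i _ => by simp [mul_assoc]
    rw [this]
    exact Finset.sum_eq_zero fun i _ => by rw [hsucc, mul_zero]
  have hc : c = 0 := by simpa [hzero] using congrFun hw 0
  refine ⟨?_, hc⟩
  have hspan : Submodule.span K (Set.range M.col) =
      Submodule.span K (Set.range (M.submatrix id Fin.succ).col) := by
    have : Set.range M.col = insert (M.col 0) (Set.range (M.submatrix id Fin.succ).col) := by
      rw [← Fin.range_cons]
      congr 1
      funext j
      refine Fin.cases ?_ (fun j => ?_) j <;> rfl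
    rw [this]
    exact Submodule.span_insert_eq_span hcol
  have hli : LinearIndependent K (M.submatrix id Fin.succ).col := by
    rw [linearIndependent_iff_card_eq_finrank_span, Set.finrank, ← hspan,
      ← Matrix.rank_eq_finrank_span_cols, Fintype.card_fin]
    omega
  refine Matrix.mulVec_injective_iff.2 hli ?_
  rw [Matrix.mulVec_zero]
  funext i
  exact Fin.cases hzero hsucc i

theorem FirstRowColDependent.exists_leftInverse {M : Matrix (Fin (n + 1)) (Fin (n + 1)) K}
    (h : FirstRowColDependent M) (hM : M.rank + 1 = n + 1) :
    ∃ W : Matrix (Fin n) (Fin (n + 1)) K, W * M.submatrix id Fin.succ = 1 :=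
  exists_leftInverse_of_mulVec_eq_zero fun _ hw =>
    (h.eq_zero_of_mulVec_add hM (c := 0) (by simpa using hw)).1

theorem FirstRowColDependent.rank_fromCols {M : Matrix (Fin (n + 1)) (Fin (n + 1)) K}
    (h : FirstRowColDependent M) (hM : M.rank + 1 = n + 1) :
    (Matrix.fromCols (M.submatrix id Fin.succ)
      (Matrix.replicateCol Unit (Pi.single (0 : Fin (n + 1)) (1 : K)))).rank = n + 1 := by
  rw [Matrix.rank, LinearMap.finrank_range_of_inj]
  · simp
  · refine (injective_iff_map_eq_zero _).2 fun v hv => ?_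
    have := h.eq_zero_of_mulVec_add hM (w := v ∘ Sum.inl) (c := v (Sum.inr ())) (by
      rw [← hv, Matrix.mulVecLin_apply, Matrix.fromCols_mulVec]
      congr 1
      funext i
      by_cases hi : i = 0 <;> simp [Matrix.mulVec, dotProduct, hi])
    funext u
    rcases u with j | ⟨⟩
    · exact congrFun this.1 j
    · exact this.2

/-- A square matrix of polynomials that is invertible at `T = 0` reflects divisibility of vectors by
powers of `T`. -/
theorem X_pow_dvd_of_mulVec {ι : Type*} [Fintype ι] [DecidableEq ι]
    {M : Matrix ι ι (Polynomial K)}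
    (hM : Function.Injective (M.map (Polynomial.eval 0)).mulVec) {k : ℕ} {z : ι → Polynomial K}
    (hz : ∀ i, Polynomial.X ^ k ∣ M.mulVec z i) (i : ι) : Polynomial.X ^ k ∣ z i := by
  have hdet : ¬ Polynomial.X ∣ M.det := by
    rw [Polynomial.X_dvd_iff, Polynomial.coeff_zero_eq_eval_zero, ← Polynomial.coe_evalRingHom,
      RingHom.map_det]
    exact ((Matrix.isUnit_iff_isUnit_det _).1 (Matrix.mulVec_injective_iff_isUnit.1 hM)).ne_zero
  refine Polynomial.prime_X.pow_dvd_of_dvd_mul_left k hdet ?_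
  have : M.det * z i = (M.adjugate.mulVec (M.mulVec z)) i := by
    rw [Matrix.mulVec_mulVec, Matrix.adjugate_mul, Matrix.smul_mulVec, Matrix.one_mulVec]
    rfl
  rw [this]
  exact Finset.dvd_sum fun j _ => (hz j).mul_left _

theorem isNonsingular_of_mulVec_eq_zero {ι κ : Type*} [Fintype ι] [Fintype κ] [DecidableEq ι]
    [DecidableEq κ] {M : Matrix ι κ K} (hcard : Fintype.card ι = Fintype.card κ)
    (hM : ∀ v, M.mulVec v = 0 → v = 0) : IsNonsingular M := by
  obtain ⟨N, hN⟩ := exists_leftInverse_of_mulVec_eq_zero hM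
  exact ⟨N, (Matrix.mul_eq_one_comm_of_equiv (Fintype.equivOfCardEq hcard.symm)).1 hN, hN⟩

end Matrices

/-! ### Regularity of the deflated system -/

section Regularity

variable {K : Type*} [Field K] {n μ : ℕ}

theorem curveAt_coeff_zero (x : Fin (n + 1) → K) (a : Fin (μ - 1) × Fin n → K)
    (j : Fin (n + 1)) : (curveAt x a j).coeff 0 = x j := by
  refine Fin.cases ?_ (fun j => ?_) j
  · simp [curveAt]
  · simp only [curveAt, Fin.cons_succ, Polynomial.coeff_add, coeff_zero_sum_fin]
    simp

theorem dvd_aeval_sub_aeval {γ δ : Fin (n + 1) → Polynomial K} {d : Polynomial K}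
    (h : ∀ j, d ∣ γ j - δ j) (p : MvPolynomial (Fin (n + 1)) K) : d ∣ aeval γ p - aeval δ p := by
  induction p using MvPolynomial.induction_on with
  | C a => simp
  | add p q hp hq =>
    convert! dvd_add hp hq using 1
    simp only [map_add]
    ring
  | mul_X p j hp =>
    convert! dvd_add (hp.mul_right (γ j)) ((h j).mul_left (aeval δ p)) using 1
    simp only [map_mul, aeval_X]
    ring

theorem derivative_aeval (γ : Fin (n + 1) → Polynomial K) (p : MvPolynomial (Fin (n + 1)) K) :
    Polynomial.derivative (aeval γ p) =
      ∑ j, aeval γ (pderiv j p) * Polynomial.derivative (γ j) :=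
  derivation_aeval (tDerivation K K) γ p

theorem X_pow_succ_dvd_of_derivative [CharZero K] {p : Polynomial K} {k : ℕ} (h0 : p.coeff 0 = 0)
    (h : Polynomial.X ^ k ∣ Polynomial.derivative p) : Polynomial.X ^ (k + 1) ∣ p := by
  rw [Polynomial.X_pow_dvd_iff] at h ⊢
  intro d hd
  cases d with
  | zero => exact h0
  | succ d =>
    have := h d (by omega)
    rw [Polynomial.coeff_derivative] at this
    exact (mul_eq_zero.1 this).resolve_right (by exact_mod_cast Nat.succ_ne_zero d)

theorem X_pow_dvd_derivative {p : Polynomial K} {k : ℕ} (h : Polynomial.X ^ k ∣ p) :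
    Polynomial.X ^ (k - 1) ∣ Polynomial.derivative p := by
  rw [Polynomial.X_pow_dvd_iff] at h ⊢
  intro d hd
  rw [Polynomial.coeff_derivative, h (d + 1) (by omega), zero_mul]

variable {F : Fin (n + 1) → MvPolynomial (Fin (n + 1)) K} {x : Fin (n + 1) → K}

/-- Along a curve through `x`, the last columns of the Jacobian matrix together with `e_1` form a
matrix that is invertible at `T = 0`, so that linear equations for it can be solved order by order in
`T`. -/
theorem X_pow_dvd_of_last_columns (hJ : FirstRowColDependent (jacobian F x))
    (hrank : (jacobian F x).rank + 1 = n + 1) {γ : Fin (n + 1) → Polynomial K}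
    (hγ : ∀ j, (γ j).coeff 0 = x j) {k : ℕ} {w : Fin n → Polynomial K} {c : Polynomial K}
    (h : ∀ i, Polynomial.X ^ k ∣
      ∑ j : Fin n, aeval γ (pderiv j.succ (F i)) * w j + c * (if i = 0 then 1 else 0)) :
    (∀ j, Polynomial.X ^ k ∣ w j) ∧ Polynomial.X ^ k ∣ c := by
  let M : Matrix (Fin (n + 1)) (Fin (n + 1)) (Polynomial K) := Matrix.of fun i =>
    Fin.cons (if i = 0 then 1 else 0) fun j => aeval γ (pderiv j.succ (F i))
  have hmul (z : Fin (n + 1) → Polynomial K) (i : Fin (n + 1)) : M.mulVec z i =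
      ∑ j : Fin n, aeval γ (pderiv j.succ (F i)) * z j.succ + z 0 * (if i = 0 then 1 else 0) := by
    rw [Matrix.mulVec, dotProduct, Fin.sum_univ_succ, add_comm, mul_comm (z 0)]
    rfl
  have hM : Function.Injective (M.map (Polynomial.eval 0)).mulVec := by
    refine (injective_iff_map_eq_zero (M.map (Polynomial.eval 0)).mulVecLin).2 fun v hv => ?_
    have h1 := hJ.eq_zero_of_mulVec_add hrank (w := fun j => v j.succ) (c := v 0) (by
      rw [← hv]
      funext i
      rw [Matrix.mulVecLin_apply, Pi.add_apply, Matrix.mulVec, Matrix.mulVec, dotProduct,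
        dotProduct, Fin.sum_univ_succ, add_comm]
      congr 1
      · by_cases hi : i = 0 <;> simp [M, hi]
      · refine Finset.sum_congr rfl fun j _ => ?_
        simp [M, jacobian, ← Polynomial.coeff_zero_eq_eval_zero, coeff_zero_aeval hγ])
    funext j
    exact Fin.cases h1.2 (congrFun h1.1) j
  have key := X_pow_dvd_of_mulVec hM (k := k) (z := Fin.cons c w) fun i => by
    simpa only [hmul, Fin.cons_succ, Fin.cons_zero] using h i
  exact ⟨fun j => by simpa using key j.succ, by simpa using key 0⟩

/-- The first component of a vector in the kernel of the Jacobian matrix of the deflated system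
vanishes. Otherwise the corresponding variation of the curve agrees, up to scaling and to the order
`μ - 1`, with the tangent vector of the curve, and its coefficient of `T ^ (μ - 1)` can be used to
prolong the curve so that the system vanishes on it to the order `μ + 1`. -/
theorem IsIsolatedRoot.eq_zero_of_dvd_linearization [CharZero K] (hroot : IsIsolatedRoot F x)
    (hJ : FirstRowColDependent (jacobian F x)) (hrank : (jacobian F x).rank + 1 = n + 1)
    (hμ : multiplicity F x = μ) {γ : Fin (n + 1) → Polynomial K}
    (hγ : ∀ j, (γ j).coeff 0 = x j) (hγ0 : γ 0 = Polynomial.C (x 0) + Polynomial.X)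
    (hF : ∀ i, Polynomial.X ^ μ ∣ aeval γ (F i)) {w : Fin (n + 1) → Polynomial K} {s : K}
    (hw0 : w 0 = Polynomial.C s) {β : Polynomial K} (hβ : β.degree < (μ - 1 : ℕ))
    (h : ∀ i, Polynomial.X ^ μ ∣
      ∑ j, aeval γ (pderiv j (F i)) * w j - β * (if i = 0 then 1 else 0)) : s = 0 := by
  by_contra hs
  have hW := hJ.exists_leftInverse hrank
  have hμ0 : 0 < μ := hμ ▸ hroot.multiplicity_pos hW
  have hγ' : Polynomial.derivative (γ 0) = 1 := by simp [hγ0]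
  -- Subtracting `s` times the tangent vector removes the first column.
  obtain ⟨hw, hβX⟩ := X_pow_dvd_of_last_columns hJ hrank hγ (k := μ - 1) (c := -β)
    (w := fun j => w j.succ - Polynomial.C s * Polynomial.derivative (γ j.succ)) fun i => by
      have h1 := (pow_dvd_pow Polynomial.X (Nat.sub_le μ 1)).trans (h i)
      have h2 := (X_pow_dvd_derivative (hF i)).mul_left (Polynomial.C s)
      convert! dvd_sub h1 h2 using 1
      rw [derivative_aeval, Fin.sum_univ_succ, Fin.sum_univ_succ, hw0, hγ']
      simp only [mul_sub, Finset.sum_sub_distrib, mul_add, Finset.mul_sum,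
        mul_left_comm (Polynomial.C s)]
      ring
  have hβ0 : β = 0 := by
    refine Polynomial.eq_zero_of_dvd_of_degree_lt ((dvd_neg).1 hβX) ?_
    rwa [Polynomial.degree_X_pow]
  have hq (j : Fin (n + 1)) : ∃ q : Polynomial K,
      w j - Polynomial.C s * Polynomial.derivative (γ j) = Polynomial.X ^ (μ - 1) * q :=
    Fin.cases ⟨0, by simp [hw0, hγ']⟩ (fun j => hw j) j
  choose q hq using hq
  have hq0 : q 0 = 0 := by
    have := hq 0
    rw [hw0, hγ', mul_one, sub_self, eq_comm] at this
    exact (mul_eq_zero.1 this).resolve_left (pow_ne_zero _ Polynomial.X_ne_zero)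
  have hμK : (μ : K) ≠ 0 := Nat.cast_ne_zero.2 hμ0.ne'
  -- The prolongation: its derivative is `w / s` modulo `T ^ μ`.
  let δ : Fin (n + 1) → Polynomial K := fun j =>
    γ j + Polynomial.C ((q j).coeff 0 / (s * μ)) * Polynomial.X ^ μ
  have hδγ (p : MvPolynomial (Fin (n + 1)) K) :
      Polynomial.X ^ μ ∣ aeval δ p - aeval γ p :=
    dvd_aeval_sub_aeval (fun j => by simp [δ]) p
  have hδ (j : Fin (n + 1)) : (δ j).coeff 0 = x j := by
    simp [δ, hγ, hμ0.ne]
  have hδ0 : δ 0 = Polynomial.C (x 0) + Polynomial.X := by simp [δ, hq0, hγ0]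
  have hδw (j : Fin (n + 1)) :
      Polynomial.X ^ μ ∣ Polynomial.C s * Polynomial.derivative (δ j) - w j := by
    have h1 : Polynomial.C s * Polynomial.derivative (δ j) - w j =
        Polynomial.X ^ (μ - 1) * (Polynomial.C ((q j).coeff 0) - q j) := by
      have h2 : Polynomial.C s * (Polynomial.C ((q j).coeff 0 / (s * μ)) *
          Polynomial.C (μ : K)) = Polynomial.C ((q j).coeff 0) := by
        rw [← Polynomial.C_mul, ← Polynomial.C_mul]
        congr 1
        field_simp
      simp only [δ, Polynomial.derivative_add, Polynomial.derivative_C_mul_X_pow,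
        Polynomial.C_mul]
      linear_combination Polynomial.X ^ (μ - 1) * h2 - hq j
    rw [h1]
    obtain ⟨m, rfl⟩ := Nat.exists_eq_succ_of_ne_zero hμ0.ne'
    rw [pow_succ]
    refine mul_dvd_mul_left _ (Polynomial.X_dvd_iff.2 ?_)
    simp
  have hFδ (i : Fin (n + 1)) : Polynomial.X ^ (μ + 1) ∣ aeval δ (F i) := by
    refine X_pow_succ_dvd_of_derivative ?_ ?_
    · rw [coeff_zero_aeval hδ, hroot.eval_eq_zero_of_mem_systemIdeal (mem_systemIdeal i)]
    · have h1 : Polynomial.X ^ μ ∣ Polynomial.C s * Polynomial.derivative (aeval δ (F i)) := by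
        have h2 := h i
        rw [hβ0, zero_mul, sub_zero] at h2
        rw [← dvd_sub_left h2, derivative_aeval, Finset.mul_sum, ← Finset.sum_sub_distrib]
        refine Finset.dvd_sum fun j _ => ?_
        convert! dvd_add ((hδw j).mul_left (aeval δ (pderiv j (F i))))
          ((hδγ (pderiv j (F i))).mul_right (w j)) using 1
        ring
      exact (IsUnit.dvd_mul_left (Polynomial.isUnit_C.2 (isUnit_iff_ne_zero.2 hs))).1 h1
  have := hroot.finite_localAlgebra hW
  have := le_multiplicity_of_dvd hδ hδ0 hFδ
  omega

theorem coeff_curveVariation_succ (v : Unknown n μ → K) (m : Fin (μ - 1)) (j : Fin n) :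
    (curveVariation v j.succ).coeff (m + 1) = v (aVar n μ m j) := by
  simp only [curveVariation, Fin.cons_succ, Polynomial.coeff_add, Polynomial.coeff_C_succ, zero_add,
    coeff_succ_sum_fin, m.2, dite_true]

theorem coeff_zero_curveVariation (v : Unknown n μ → K) (j : Fin (n + 1)) :
    (curveVariation v j).coeff 0 = v (xVar n μ j) := by
  refine Fin.cases ?_ (fun j => ?_) j
  · simp [curveVariation]
  · simp only [curveVariation, Fin.cons_succ, Polynomial.coeff_add, coeff_zero_sum_fin]
    simp

theorem IsIsolatedRoot.deflatedJacobian_mulVec_injective [CharZero K]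
    (hroot : IsIsolatedRoot F x) (hJ : FirstRowColDependent (jacobian F x))
    (hrank : (jacobian F x).rank + 1 = n + 1) (hμ : multiplicity F x = μ)
    {a : Fin (μ - 1) × Fin n → K} (ha : IsDeflatedZero F x 0 a) {v : Unknown n μ → K}
    (hv : (deflatedJacobian F x 0 a).mulVec v = 0) : v = 0 := by
  have hμ0 : 0 < μ := hμ ▸ hroot.multiplicity_pos (hJ.exists_leftInverse hrank)
  have hγ := curveAt_coeff_zero (μ := μ) x a
  let β₀ : Polynomial K := ∑ ν : Fin (μ - 1),
    Polynomial.C (((ν : ℕ).factorial : K)⁻¹ * v (bVar n μ ν)) * Polynomial.X ^ (ν : ℕ)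
  let β : Polynomial K := Polynomial.taylor (x 0) β₀
  have hβeq : β = ∑ ν : Fin (μ - 1), Polynomial.C (((ν : ℕ).factorial : K)⁻¹ * v (bVar n μ ν)) *
      (Polynomial.X + Polynomial.C (x 0)) ^ (ν : ℕ) := by
    simp only [β, β₀, map_sum, Polynomial.taylor_mul, Polynomial.taylor_C, Polynomial.taylor_pow,
      Polynomial.taylor_X]
  have hβ : β.degree < (μ - 1 : ℕ) := by
    rw [Polynomial.degree_taylor]
    exact Polynomial.degree_sum_fin_lt _
  have hlin (i : Fin (n + 1)) : Polynomial.X ^ μ ∣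
      ∑ j, aeval (curveAt x a) (pderiv j (F i)) * curveVariation v j -
        β * (if i = 0 then 1 else 0) := by
    rw [Polynomial.X_pow_dvd_iff]
    intro k hk
    have := congrFun hv (⟨k, hk⟩, i)
    rwa [deflatedJacobian_mulVec, ← hβeq] at this
  have hs : v (xVar n μ 0) = 0 := hroot.eq_zero_of_dvd_linearization hJ hrank hμ hγ rfl
    ((isDeflatedZero_iff F x a).1 ha) rfl hβ hlin
  obtain ⟨hw, hβX⟩ := X_pow_dvd_of_last_columns hJ hrank hγ (k := μ) (c := -β)
    (w := fun j => curveVariation v j.succ) fun i => by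
      have h1 : curveVariation v 0 = 0 := by simp [curveVariation, hs]
      simpa only [Fin.sum_univ_succ, h1, mul_zero, zero_add, sub_eq_add_neg, neg_mul] using hlin i
  have hβ₀ : β₀ = 0 := by
    refine Polynomial.taylor_injective (x 0) ?_
    rw [map_zero]
    refine Polynomial.eq_zero_of_dvd_of_degree_lt (dvd_neg.1 hβX) (hβ.trans_le ?_)
    rw [Polynomial.degree_X_pow]
    exact_mod_cast Nat.sub_le μ 1
  funext u
  rcases u with j | ν | ⟨m, j⟩
  · refine Fin.cases hs (fun j => ?_) j
    change v (xVar n μ j.succ) = 0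
    rw [← coeff_zero_curveVariation v]
    exact Polynomial.X_pow_dvd_iff.1 (hw j) 0 hμ0
  · have h1 : β₀.coeff ν = ((ν : ℕ).factorial : K)⁻¹ * v (bVar n μ ν) := by
      simp only [β₀, Polynomial.finsetSum_coeff, Polynomial.coeff_C_mul_X_pow]
      rw [Finset.sum_eq_single ν]
      · simp
      · intro m _ hm
        rw [if_neg]
        exact fun e => hm (Fin.ext e.symm)
      · simp
    rw [hβ₀, Polynomial.coeff_zero, zero_eq_mul] at h1
    exact h1.resolve_left (inv_ne_zero (Nat.cast_ne_zero.2 (Nat.factorial_ne_zero _)))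
  · change v (aVar n μ m j) = 0
    rw [← coeff_curveVariation_succ v]
    exact Polynomial.X_pow_dvd_iff.1 (hw j) _ (by omega)

theorem IsIsolatedRoot.isNonsingular_deflatedJacobian [CharZero K]
    (hroot : IsIsolatedRoot F x) (hJ : FirstRowColDependent (jacobian F x))
    (hrank : (jacobian F x).rank + 1 = n + 1) (hμ : multiplicity F x = μ)
    {a : Fin (μ - 1) × Fin n → K} (ha : IsDeflatedZero F x 0 a) :
    IsNonsingular (deflatedJacobian F x 0 a) := by
  have hμ0 : 0 < μ := hμ ▸ hroot.multiplicity_pos (hJ.exists_leftInverse hrank)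
  refine isNonsingular_of_mulVec_eq_zero ?_ fun v hv =>
    hroot.deflatedJacobian_mulVec_injective hJ hrank hμ ha hv
  obtain ⟨m, rfl⟩ := Nat.exists_eq_succ_of_ne_zero hμ0.ne'
  simp only [Fintype.card_prod, Fintype.card_sum, Fintype.card_fin, Nat.succ_eq_add_one,
    Nat.add_sub_cancel]
  ring

theorem IsIsolatedRoot.exists_isDeflatedZero [CharZero K]
    (hroot : IsIsolatedRoot F x) (hJ : FirstRowColDependent (jacobian F x))
    (hrank : (jacobian F x).rank + 1 = n + 1) (hμ : multiplicity F x = μ) :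
    ∃ a : Fin (μ - 1) × Fin n → K, IsDeflatedZero F x 0 a := by
  obtain ⟨a, ha⟩ := hroot.exists_curveAt (hJ.exists_leftInverse hrank) hμ
  exact ⟨a, (isDeflatedZero_iff F x a).2 ha⟩

end Regularity

/-! ### Exchanges of variables and equations -/

section Exchange

variable {K : Type*} [Field K] {n : ℕ} {F : Fin (n + 1) → MvPolynomial (Fin (n + 1)) K}
  {x : Fin (n + 1) → K}

theorem eval_exchangePoint_rename (s : Fin (n + 1)) (p : MvPolynomial (Fin (n + 1)) K) :
    eval (exchangePoint s x) (rename (Equiv.swap 0 s) p) = eval x p := by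
  rw [eval_rename]
  congr 2
  funext i
  simp [exchangePoint]

theorem systemIdeal_exchange (s t : Fin (n + 1)) :
    systemIdeal (exchange s t F) =
      (systemIdeal F).comap (renameEquiv K (Equiv.swap 0 s)).symm := by
  have h : Set.range (exchange s t F) = renameEquiv K (Equiv.swap 0 s) '' Set.range F := by
    rw [← Set.range_comp, ← (Equiv.swap 0 t).surjective.range_comp]
    congr 1
    funext i
    simp [exchange]
  rw [systemIdeal, systemIdeal, h, ← Ideal.map_span]
  exact (Ideal.comap_symm (I := Ideal.span (Set.range F))
    (renameEquiv K (Equiv.swap 0 s)).toRingEquiv).symm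

theorem eval_symm_renameEquiv (s : Fin (n + 1)) (p : MvPolynomial (Fin (n + 1)) K) :
    eval x ((renameEquiv K (Equiv.swap 0 s)).symm p) = eval (exchangePoint s x) p := by
  rw [← eval_exchangePoint_rename s]
  exact congrArg _ ((renameEquiv K (Equiv.swap 0 s)).apply_symm_apply p)

theorem IsIsolatedRoot.exchange (h : IsIsolatedRoot F x) (s t : Fin (n + 1)) :
    IsIsolatedRoot (exchange s t F) (exchangePoint s x) := by
  have hv : vanishingIdeal K {exchangePoint s x} =
      (vanishingIdeal K {x}).comap (renameEquiv K (Equiv.swap 0 s)).symm := by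
    ext p
    rw [Ideal.mem_comap, mem_vanishingIdeal_singleton, mem_vanishingIdeal_singleton,
      eval_symm_renameEquiv]
  rw [IsIsolatedRoot, systemIdeal_exchange, hv]
  let f : MvPolynomial (Fin (n + 1)) K →+* MvPolynomial (Fin (n + 1)) K :=
    RingHomClass.toRingHom (renameEquiv K (Equiv.swap 0 s)).symm
  have hf : Function.Surjective f := (renameEquiv K (Equiv.swap 0 s)).symm.surjective
  exact Ideal.minimalPrimes_comap_of_surjective hf h

theorem multiplicity_exchange (s t : Fin (n + 1)) :
    multiplicity (exchange s t F) (exchangePoint s x) = multiplicity F x := by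
  set e := renameEquiv K (Equiv.swap 0 s)
  have h : primaryComponent (exchange s t F) (exchangePoint s x) =
      (primaryComponent F x).map (e : _ →+* _) := by
    ext q
    have h1 : q ∈ (primaryComponent F x).map (e : _ →+* _) ↔ e.symm q ∈ primaryComponent F x := by
      rw [← Ideal.mem_comap]
      exact (Ideal.comap_symm (I := primaryComponent F x) e.toRingEquiv).symm ▸ Iff.rfl
    rw [h1, mem_primaryComponent_iff, mem_primaryComponent_iff, systemIdeal_exchange]
    simp only [Ideal.mem_comap, map_mul, ← eval_symm_renameEquiv]
    exact e.symm.surjective.exists (p := fun r =>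
      eval x r ≠ 0 ∧ r * e.symm q ∈ systemIdeal F) |>.symm
  exact (Ideal.quotientEquivAlg _ _ e h).toLinearEquiv.finrank_eq.symm

theorem jacobian_exchange (s t : Fin (n + 1)) :
    jacobian (exchange s t F) (exchangePoint s x) =
      (jacobian F x).submatrix (Equiv.swap 0 t) (Equiv.swap 0 s) := by
  ext i j
  simp only [jacobian, Matrix.of_apply, Matrix.submatrix_apply, exchange]
  rw [← eval_exchangePoint_rename s (pderiv (Equiv.swap 0 s j) _),
    ← pderiv_rename (Equiv.swap 0 s).injective, Equiv.swap_apply_self]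

theorem firstRowColDependent_of_kernel {M : Matrix (Fin (n + 1)) (Fin (n + 1)) K}
    {v u : Fin (n + 1) → K} (hv : M.mulVec v = 0) (hv0 : v 0 ≠ 0) (hu : Matrix.vecMul u M = 0)
    (hu0 : u 0 ≠ 0) : FirstRowColDependent M := by
  constructor
  · refine (Submodule.mem_span_range_iff_exists_fun K).2 ⟨fun j => -(v j.succ / v 0), ?_⟩
    funext i
    have := congrFun hv i
    rw [Matrix.mulVec, dotProduct, Fin.sum_univ_succ, Pi.zero_apply] at this
    simp only [Finset.sum_apply, Pi.smul_apply, smul_eq_mul, neg_mul, Finset.sum_neg_distrib,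
      div_mul_eq_mul_div, ← Finset.sum_div]
    simp only [mul_comm (M i _)] at this
    field_simp
    linear_combination -this
  · refine (Submodule.mem_span_range_iff_exists_fun K).2 ⟨fun j => -(u j.succ / u 0), ?_⟩
    funext j
    have := congrFun hu j
    rw [Matrix.vecMul, dotProduct, Fin.sum_univ_succ, Pi.zero_apply] at this
    simp only [Finset.sum_apply, Pi.smul_apply, smul_eq_mul, neg_mul, Finset.sum_neg_distrib,
      div_mul_eq_mul_div, ← Finset.sum_div]
    field_simp
    linear_combination -this

/-- The exchanges bring nonzero entries of a right and of a left kernel vector into the first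
position. -/
theorem exists_firstRowColDependent_submatrix {M : Matrix (Fin (n + 1)) (Fin (n + 1)) K}
    (hM : M.rank + 1 = n + 1) :
    ∃ s t, FirstRowColDependent (M.submatrix (Equiv.swap 0 t) (Equiv.swap 0 s)) := by
  have hdet : M.det = 0 := by
    by_contra hdet
    have := Matrix.rank_of_isUnit M ((Matrix.isUnit_iff_isUnit_det M).2 (isUnit_iff_ne_zero.2 hdet))
    rw [Fintype.card_fin] at this
    omega
  obtain ⟨v, hv0, hv⟩ := Matrix.exists_mulVec_eq_zero_iff.2 hdet
  obtain ⟨u, hu0, hu⟩ := Matrix.exists_vecMul_eq_zero_iff.2 hdet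
  obtain ⟨s, hs⟩ := Function.ne_iff.1 hv0
  obtain ⟨t, ht⟩ := Function.ne_iff.1 hu0
  refine ⟨s, t, firstRowColDependent_of_kernel (v := v ∘ Equiv.swap 0 s)
    (u := u ∘ Equiv.swap 0 t) ?_ (by simpa using hs) ?_ (by simpa using ht)⟩
  · rw [Matrix.submatrix_mulVec_equiv]
    funext i
    have h1 : (v ∘ Equiv.swap 0 s) ∘ (Equiv.swap 0 s).symm = v := by
      funext k
      simp
    rw [h1]
    exact congrFun hv (Equiv.swap 0 t i)
  · rw [Matrix.submatrix_vecMul_equiv]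
    funext i
    have h1 : (u ∘ Equiv.swap 0 t) ∘ (Equiv.swap 0 t).symm = u := by
      funext k
      simp
    rw [h1]
    exact congrFun hu (Equiv.swap 0 s i)

end Exchange

end BreadthOne

end

theorem theorem5 {K : Type*} [Field K] [CharZero K] (n μ : ℕ)
    (F : Fin (n + 1) → MvPolynomial (Fin (n + 1)) K) (x : Fin (n + 1) → K)
    (hroot : BreadthOne.IsIsolatedRoot F x)
    (hmult : BreadthOne.multiplicity F x = μ)
    (hcorank : (BreadthOne.jacobian F x).rank + 1 = n + 1) :
    (BreadthOne.FirstRowColDependent (BreadthOne.jacobian F x) →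
      (Matrix.fromCols (BreadthOne.lastColumns F x)
          (Matrix.replicateCol Unit (Pi.single (0 : Fin (n + 1)) (1 : K)))).rank = n + 1 ∧
      (∃ a : Fin (μ - 1) × Fin n → K, BreadthOne.IsDeflatedZero F x 0 a) ∧
      (∀ a : Fin (μ - 1) × Fin n → K, BreadthOne.IsDeflatedZero F x 0 a →
        BreadthOne.IsNonsingular (BreadthOne.deflatedJacobian F x 0 a))) ∧
    (∃ s t : Fin (n + 1),
      BreadthOne.FirstRowColDependent
        (BreadthOne.jacobian (BreadthOne.exchange s t F) (BreadthOne.exchangePoint s x)) ∧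
      ∃ a : Fin (μ - 1) × Fin n → K,
        BreadthOne.IsDeflatedZero (BreadthOne.exchange s t F) (BreadthOne.exchangePoint s x) 0 a ∧
        BreadthOne.IsNonsingular
          (BreadthOne.deflatedJacobian (BreadthOne.exchange s t F)
            (BreadthOne.exchangePoint s x) 0 a)) := by
  refine ⟨fun hJ => ⟨hJ.rank_fromCols hcorank, hroot.exists_isDeflatedZero hJ hcorank hmult,
    fun a ha => hroot.isNonsingular_deflatedJacobian hJ hcorank hmult ha⟩, ?_⟩
  obtain ⟨s, t, hJ⟩ := BreadthOne.exists_firstRowColDependent_submatrix hcorank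
  have hroot' := hroot.exchange s t
  have hmult' := (BreadthOne.multiplicity_exchange (F := F) (x := x) s t).trans hmult
  have hcorank' : (BreadthOne.jacobian (BreadthOne.exchange s t F)
      (BreadthOne.exchangePoint s x)).rank + 1 = n + 1 := by
    rw [BreadthOne.jacobian_exchange, Matrix.rank_submatrix, hcorank]
  rw [← BreadthOne.jacobian_exchange] at hJ
  obtain ⟨a, ha⟩ := hroot'.exists_isDeflatedZero hJ hcorank' hmult'
  exact ⟨s, t, hJ, a, ha, hroot'.isNonsingular_deflatedJacobian hJ hcorank' hmult' ha⟩
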